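/- A virtual knot diagram is a generic smooth immersion of the oriented circle into the plane (its only self-intersections are transversal double points) whose double points are divided into real crossings, which carry over/under information, and virtual crossings, which carry none. Its Gauss diagram is the circle with one signed arrow for each real crossing, from the upper to the lower preimage; the sign is the local writhe. Virtual knots are virtual knot diagrams modulo the equivalence relation generated by the Reidemeister moves and the virtual moves; equivalently, modulo orientation-preserving homeomorphisms of the circle and Reidemeister moves of the Gauss diagrams. Classical knots are diagrams without virtual crossings modulo Reidemeister moves and isotopy (of the sphere); every classical knot gives a virtual knot. For a virtual knot diagram $D$ and a finite set $S$ of real crossings of $D$, the diagram $D$ with semi-virtual crossings at $S$ is the formal sum $$D^{sv}_S=\sum_{T\subseteq S}(-1)^{|T|}D_{T\to\mathrm{virt}},$$ where $D_{T\to\mathrm{virt}}$ is obtained by making the crossings in $T$ virtual. Let $G$ be an abelian group. An invariant $\nu$ of virtual knots with values in $G$, extended linearly to formal sums of diagrams, is of finite type of degree $\le n$ if it vanishes on all diagrams with more than $n$ semi-virtual crossings. An invariant $\mu$ of classical knots with values in $G$ is a finite type (Vassiliev) invariant of degree $\le n$ if for every classical knot diagram $D$ and every set $S$ of $n+1$ crossings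 of $D$ $$\sum_{T\subseteq S}(-1)^{|T|}\mu(D_{T\to\mathrm{switched}})=0,$$ where $D_{T\to\mathrm{switched}}$ is obtained by switching the crossings in $T$. Then the following hold. 1. For every virtual knot diagram $D$ and every real crossing $c$ of $D$, if $D'$ denotes $D$ with $c$ switched and $c'$ the switched crossing, then $D-D'=D^{sv}_{\{c\}}-(D')^{sv}_{\{c'\}}$ as formal sums of diagrams; that is, a double point is the difference of two semi-virtual crossings. 2. For every abelian group $G$ and every $n\ge 0$, if a $G$-valued invariant of virtual knots is of finite type of degree $\le n$ (in particular, if its degree, the least such number, is $n$), then its restriction to classical knots is a finite type (Vassiliev) invariant of degree $\le n$. -/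

import Mathlib

open scoped ContDiff

namespace VirtualKnotTheory

/-! ### Gauss diagrams and their moves -/

/-- An arrow of a Gauss diagram: it points from the preimage of a crossing on the upper branch to
the preimage on the lower branch, and carries the sign (local writhe) of the crossing. -/
@[ext]
structure Arrow where
  tail : UnitAddCircle
  head : UnitAddCircle
  sign : ℤˣ

/-- A Gauss diagram on the oriented circle `ℝ / ℤ`: finitely many signed arrows, with all
end points pairwise distinct. -/
structure GaussDiagram where
  arrows : Finset Arrow
  tail_ne_head : ∀ a ∈ arrows, a.tail ≠ a.head
  disjoint : ∀ a ∈ arrows, ∀ b ∈ arrows, a ≠ b →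
    a.tail ≠ b.tail ∧ a.tail ≠ b.head ∧ a.head ≠ b.tail ∧ a.head ≠ b.head

/-- No arrow of `E` ends strictly inside the arc that runs from `x` to `y` in the positive
direction of the circle. -/
def GaussDiagram.FreeArc (E : GaussDiagram) (x y : UnitAddCircle) : Prop :=
  ∀ a ∈ E.arrows, ¬ sbtw x a.tail y ∧ ¬ sbtw x a.head y

/-- `x` and `y` are neighbours on the circle of `E`; `x` comes first if `o = 1`, and `y` comes
first if `o = -1`. -/
def GaussDiagram.Neighbours (E : GaussDiagram) (o : ℤˣ) (x y : UnitAddCircle) : Prop :=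
  (o = 1 ∧ E.FreeArc x y) ∨ (o = -1 ∧ E.FreeArc y x)

/-- The image of an arrow under a map of the circle. -/
def Arrow.map (h : UnitAddCircle → UnitAddCircle) (a : Arrow) : Arrow :=
  ⟨h a.tail, h a.head, a.sign⟩

open scoped Classical in
/-- The elementary equivalences of Gauss diagrams: orientation preserving homeomorphisms of the
circle, and the counterparts of the three Reidemeister moves (in all their versions).

In the third move `p`, `q`, `r` are the crossings of the top branch with the middle one, of the top
branch with the bottom one, and of the middle branch with the bottom one. On each of the three
branches the two crossings exchange their places. The numbers `oT`, `oM`, `oB` record the orders of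
the two crossings on the top, middle and bottom branch; the condition that relates them to the signs
holds exactly for triangles formed by three oriented lines in the oriented plane. -/
inductive GaussMove : GaussDiagram → GaussDiagram → Prop
  | homeo (E E' : GaussDiagram) (h : UnitAddCircle ≃ₜ UnitAddCircle)
      (hor : ∀ x y z, sbtw x y z → sbtw (h x) (h y) (h z))
      (hE : E'.arrows = E.arrows.image (Arrow.map h)) : GaussMove E E'
  | reidemeister_one (E E' : GaussDiagram) (a : Arrow)
      (ha : a ∉ E.arrows) (hE : E'.arrows = insert a E.arrows)
      (hab : E'.FreeArc a.tail a.head ∨ E'.FreeArc a.head a.tail) : GaussMove E E'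
  | reidemeister_two (E E' : GaussDiagram) (a b : Arrow)
      (ha : a ∉ E.arrows) (hb : b ∉ E.arrows) (hne : a ≠ b)
      (hE : E'.arrows = insert a (insert b E.arrows))
      (hsign : b.sign = -a.sign)
      (htail : E'.FreeArc a.tail b.tail ∨ E'.FreeArc b.tail a.tail)
      (hhead : E'.FreeArc a.head b.head ∨ E'.FreeArc b.head a.head) : GaussMove E E'
  | reidemeister_three (E E' : GaussDiagram) (F : Finset Arrow) (p q r : Arrow) (oT oM oB : ℤˣ)
      (hp : p ∉ F) (hq : q ∉ F) (hr : r ∉ F) (hpq : p ≠ q) (hpr : p ≠ r) (hqr : q ≠ r)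
      (hE : E.arrows = insert p (insert q (insert r F)))
      (hT : E.Neighbours oT p.tail q.tail)
      (hM : E.Neighbours oM p.head r.tail)
      (hB : E.Neighbours oB q.head r.head)
      (hsign₁ : p.sign * (oT * oM) = q.sign * (oT * oB))
      (hsign₂ : q.sign * (oT * oB) = r.sign * (oM * oB))
      (hE' : E'.arrows = insert ⟨q.tail, r.tail, p.sign⟩
        (insert ⟨p.tail, r.head, q.sign⟩ (insert ⟨p.head, q.head, r.sign⟩ F))) :
      GaussMove E E'

/-! ### Virtual knot diagrams -/

/-- The velocity of a closed plane curve. -/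
noncomputable def velocity (γ : UnitAddCircle → ℝ × ℝ) (x : UnitAddCircle) : ℝ × ℝ :=
  deriv (fun t : ℝ => γ (x + (t : UnitAddCircle))) 0

/-- The determinant of two vectors of the plane. -/
def planeDet (v w : ℝ × ℝ) : ℝ := v.1 * w.2 - v.2 * w.1

/-- A virtual knot diagram: a generic immersion of the circle into the plane (there are only
transversal double points; by compactness there are finitely many of them), some of whose double
points are real crossings. A real crossing is recorded as the pair
(preimage on the upper branch, preimage on the lower branch). The double points that are
not recorded are the virtual crossings. -/
@[ext]
structure VirtualKnotDiagram where
  curve : UnitAddCircle → ℝ × ℝ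
  smooth : ContDiff ℝ ∞ (fun t : ℝ => curve (t : UnitAddCircle))
  immersion : ∀ x, velocity curve x ≠ 0
  no_triple_point : ∀ x y z, curve x = curve y → curve y = curve z → x = y ∨ y = z ∨ x = z
  transversal : ∀ x y, x ≠ y → curve x = curve y →
    planeDet (velocity curve x) (velocity curve y) ≠ 0
  crossings : Finset (UnitAddCircle × UnitAddCircle)
  double_point : ∀ c ∈ crossings, c.1 ≠ c.2 ∧ curve c.1 = curve c.2
  asymm : ∀ c ∈ crossings, c.swap ∉ crossings

namespace VirtualKnotDiagram

/-- The sign (local writhe) of the crossing `c = (over, under)`. -/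
noncomputable def sign (D : VirtualKnotDiagram) (c : UnitAddCircle × UnitAddCircle) : ℤˣ :=
  if 0 < planeDet (velocity D.curve c.1) (velocity D.curve c.2) then 1 else -1

lemma endpoints_ne (D : VirtualKnotDiagram) {c d : UnitAddCircle × UnitAddCircle}
    (hc : c ∈ D.crossings) (hd : d ∈ D.crossings) (hcd : c ≠ d) :
    c.1 ≠ d.1 ∧ c.1 ≠ d.2 ∧ c.2 ≠ d.1 ∧ c.2 ≠ d.2 := by
  obtain ⟨c1, c2⟩ := c
  obtain ⟨d1, d2⟩ := d
  obtain ⟨hc1, hc2⟩ := D.double_point _ hc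
  obtain ⟨hd1, hd2⟩ := D.double_point _ hd
  have ha := D.asymm _ hc
  simp only [Prod.swap_prod_mk, ne_eq, Prod.mk.injEq, not_and] at *
  refine ⟨?_, ?_, ?_, ?_⟩ <;> rintro rfl
  · rcases D.no_triple_point c2 c1 d2 hc2.symm hd2 with h | h | h
    · exact hc1 h.symm
    · exact hd1 h
    · exact hcd rfl h
  · rcases D.no_triple_point c2 c1 d1 hc2.symm hd2.symm with h | h | h
    · exact hc1 h.symm
    · exact hd1 h.symm
    · subst h; exact ha hd
  · rcases D.no_triple_point c1 c2 d2 hc2 hd2 with h | h | h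
    · exact hc1 h
    · exact hd1 h
    · subst h; exact ha hd
  · rcases D.no_triple_point c1 c2 d1 hc2 hd2.symm with h | h | h
    · exact hc1 h
    · exact hd1 h.symm
    · exact hcd h rfl

open scoped Classical in
/-- The Gauss diagram of a virtual knot diagram; virtual crossings are disregarded. -/
noncomputable def gauss (D : VirtualKnotDiagram) : GaussDiagram where
  arrows := D.crossings.image fun c => ⟨c.1, c.2, D.sign c⟩
  tail_ne_head := by
    intro a ha
    obtain ⟨c, hc, rfl⟩ := Finset.mem_image.1 ha
    exact (D.double_point c hc).1
  disjoint := by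
    intro a ha b hb hab
    obtain ⟨c, hc, rfl⟩ := Finset.mem_image.1 ha
    obtain ⟨d, hd, rfl⟩ := Finset.mem_image.1 hb
    exact D.endpoints_ne hc hd (fun h => hab (by rw [h]))

open scoped Classical in
/-- The diagram obtained by turning the real crossings in `S` into virtual ones. -/
noncomputable def virtualize (D : VirtualKnotDiagram)
    (S : Finset (UnitAddCircle × UnitAddCircle)) : VirtualKnotDiagram where
  curve := D.curve
  smooth := D.smooth
  immersion := D.immersion
  no_triple_point := D.no_triple_point
  transversal := D.transversal
  crossings := D.crossings \ S
  double_point := fun c hc => D.double_point c (Finset.mem_sdiff.1 hc).1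
  asymm := fun c hc h => D.asymm c (Finset.mem_sdiff.1 hc).1 (Finset.mem_sdiff.1 h).1

open scoped Classical in
/-- The diagram obtained by switching the real crossings in `S`, that is, by exchanging the upper
and the lower branch there. -/
noncomputable def switch (D : VirtualKnotDiagram)
    (S : Finset (UnitAddCircle × UnitAddCircle)) : VirtualKnotDiagram where
  curve := D.curve
  smooth := D.smooth
  immersion := D.immersion
  no_triple_point := D.no_triple_point
  transversal := D.transversal
  crossings := (D.crossings \ S) ∪ (D.crossings ∩ S).image Prod.swap
  double_point := by
    intro c hc
    rcases Finset.mem_union.1 hc with h | h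
    · exact D.double_point c (Finset.mem_sdiff.1 h).1
    · obtain ⟨d, hd, rfl⟩ := Finset.mem_image.1 h
      obtain ⟨h1, h2⟩ := D.double_point d (Finset.mem_inter.1 hd).1
      exact ⟨h1.symm, h2.symm⟩
  asymm := by
    intro c hc hc'
    simp only [Finset.mem_union, Finset.mem_sdiff, Finset.mem_image, Finset.mem_inter] at hc hc'
    rcases hc with ⟨h1, h2⟩ | ⟨d, ⟨h1, h2⟩, rfl⟩
    · rcases hc' with ⟨h3, -⟩ | ⟨e, ⟨h3, h4⟩, h5⟩
      · exact D.asymm c h1 h3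
      · exact h2 (Prod.swap_injective h5 ▸ h4)
    · rw [Prod.swap_swap] at hc'
      rcases hc' with ⟨-, h4⟩ | ⟨e, ⟨h3, -⟩, h5⟩
      · exact h4 h2
      · exact D.asymm e h3 (h5 ▸ h1)

/-- A diagram is classical if it has no virtual crossings. -/
def IsClassical (D : VirtualKnotDiagram) : Prop :=
  ∀ x y, x ≠ y → D.curve x = D.curve y → (x, y) ∈ D.crossings ∨ (y, x) ∈ D.crossings

lemma IsClassical.switch {D : VirtualKnotDiagram} (hD : D.IsClassical)
    (S : Finset (UnitAddCircle × UnitAddCircle)) : (D.switch S).IsClassical := by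
  have key : ∀ x y, (x, y) ∈ D.crossings →
      (x, y) ∈ (D.switch S).crossings ∨ (y, x) ∈ (D.switch S).crossings := by
    intro x y h
    by_cases hS : (x, y) ∈ S
    · right
      exact Finset.mem_union_right _
        (Finset.mem_image.2 ⟨(x, y), Finset.mem_inter.2 ⟨h, hS⟩, rfl⟩)
    · left
      exact Finset.mem_union_left _ (Finset.mem_sdiff.2 ⟨h, hS⟩)
  intro x y hxy h
  rcases hD x y hxy h with h' | h'
  · exact key x y h'
  · exact (key y x h').symm

/-- The diagram `D` with the crossings in `S` made semi-virtual: the formal alternating sum, over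
all subsets `T` of `S`, of the diagrams in which the crossings in `T` are made virtual. -/
noncomputable def semiVirtual (D : VirtualKnotDiagram)
    (S : Finset (UnitAddCircle × UnitAddCircle)) : FreeAbelianGroup VirtualKnotDiagram :=
  ∑ T ∈ S.powerset, (-1 : ℤ) ^ T.card • FreeAbelianGroup.of (D.virtualize T)

end VirtualKnotDiagram

/-! ### Virtual knots -/

/-- Virtual knots: virtual knot diagrams up to moves. Virtual moves do not change the
Gauss diagram, and diagrams with equal Gauss diagrams are related by virtual moves, so all
moves are expressed by Gauss diagrams. -/
def VirtualKnot : Type :=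
  Quot fun D D' : VirtualKnotDiagram => GaussMove D.gauss D'.gauss

/-- The virtual knot presented by a virtual knot diagram. -/
def VirtualKnotDiagram.toKnot (D : VirtualKnotDiagram) : VirtualKnot := Quot.mk _ D

/-- The linear extension of an invariant of virtual knots to formal sums of diagrams. -/
noncomputable def VirtualKnot.extend {G : Type*} [AddCommGroup G] (ν : VirtualKnot → G) :
    FreeAbelianGroup VirtualKnotDiagram →+ G :=
  FreeAbelianGroup.lift fun D => ν D.toKnot

/-- `ν` is a finite type invariant of virtual knots of degree at most `n`: it vanishes on
all diagrams with more than `n` semi-virtual crossings. -/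
def VirtualKnot.FiniteTypeLE {G : Type*} [AddCommGroup G] (ν : VirtualKnot → G) (n : ℕ) : Prop :=
  ∀ (D : VirtualKnotDiagram) (S : Finset (UnitAddCircle × UnitAddCircle)),
    S ⊆ D.crossings → n < S.card → VirtualKnot.extend ν (D.semiVirtual S) = 0

/-! ### Classical knots -/

/-- Diagrams of classical knots. -/
def ClassicalKnotDiagram : Type := {D : VirtualKnotDiagram // D.IsClassical}

/-- Crossing changes of a classical diagram. -/
noncomputable def ClassicalKnotDiagram.switch (D : ClassicalKnotDiagram)
    (S : Finset (UnitAddCircle × UnitAddCircle)) : ClassicalKnotDiagram :=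
  ⟨D.1.switch S, D.2.switch S⟩

/-- Classical knots: classical diagrams up to Reidemeister moves through classical diagrams.
A Gauss diagram determines a classical diagram up to isotopy of the sphere. -/
def ClassicalKnot : Type :=
  Quot fun D D' : ClassicalKnotDiagram => GaussMove D.1.gauss D'.1.gauss

/-- The knot presented by a classical diagram. -/
def ClassicalKnotDiagram.toKnot (D : ClassicalKnotDiagram) : ClassicalKnot := Quot.mk _ D

/-- A classical knot considered as a virtual knot. -/
def ClassicalKnot.toVirtual : ClassicalKnot → VirtualKnot :=
  Quot.map Subtype.val fun _ _ h => h

/-- `μ` is a finite type (Vassiliev) invariant of classical knots of degree at most `n`: for every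
classical diagram and every set of `n + 1` crossings of it, the alternating sum of `μ` over all
switchings of these crossings vanishes. -/
def ClassicalKnot.FiniteTypeLE {G : Type*} [AddCommGroup G] (μ : ClassicalKnot → G) (n : ℕ) :
    Prop :=
  ∀ (D : ClassicalKnotDiagram) (S : Finset (UnitAddCircle × UnitAddCircle)),
    S ⊆ D.1.crossings → S.card = n + 1 →
      ∑ T ∈ S.powerset, (-1 : ℤ) ^ T.card • μ (D.switch T).toKnot = 0

end VirtualKnotTheory

namespace VirtualKnotTheory

namespace VirtualKnotDiagram

/-! A virtual crossing has no over/under information, so `D` and `D` switched at `c` become the same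
diagram once that crossing is virtual. These terms cancel in the difference of the two semi-virtual
diagrams, which gives the first claim.

For a set `S` of crossings, take the alternating sum over `T ⊆ S` of the diagrams `D.switch T` made
semi-virtual at `S`. Expanding gives a double sum over `T` and the set `U ⊆ S` of crossings made
virtual. For fixed nonempty `U`, the sum over `T` cancels in pairs, because switching a virtual
crossing does nothing (`sum_switch_virtualize_eq_zero`). Only `U = ∅` survives, and it is the
Vassiliev alternating sum (`sum_switch_eq_sum_semiVirtual`). An invariant of degree at most `n`
kills every semi-virtual term when `S` has `n + 1` elements. -/

lemma mem_crossings_virtualize {D : VirtualKnotDiagram}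
    {S : Finset (UnitAddCircle × UnitAddCircle)} {c : UnitAddCircle × UnitAddCircle} :
    c ∈ (D.virtualize S).crossings ↔ c ∈ D.crossings ∧ c ∉ S :=
  Finset.mem_sdiff

lemma mem_crossings_switch {D : VirtualKnotDiagram}
    {S : Finset (UnitAddCircle × UnitAddCircle)} {c : UnitAddCircle × UnitAddCircle} :
    c ∈ (D.switch S).crossings ↔
      (c ∈ D.crossings ∧ c ∉ S) ∨ (c.swap ∈ D.crossings ∧ c.swap ∈ S) := by
  simp only [switch, Finset.mem_union, Finset.mem_sdiff, Finset.mem_image, Finset.mem_inter]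
  refine or_congr_right ⟨?_, fun h => ⟨c.swap, h, c.swap_swap⟩⟩
  rintro ⟨d, hd, rfl⟩
  simpa using hd

@[simp]
lemma virtualize_empty (D : VirtualKnotDiagram) : D.virtualize ∅ = D := by
  ext c
  · rfl
  · rfl
  · simp [mem_crossings_virtualize]

/-! ### A single crossing -/

lemma semiVirtual_singleton (D : VirtualKnotDiagram) (c : UnitAddCircle × UnitAddCircle) :
    D.semiVirtual {c} =
      FreeAbelianGroup.of D - FreeAbelianGroup.of (D.virtualize {c}) := by
  classical
  rw [semiVirtual, ← insert_empty_eq c, Finset.sum_powerset_insert (Finset.notMem_empty c)]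
  simp [sub_eq_add_neg]

/-- Making a crossing virtual forgets its over/under information. -/
lemma virtualize_switch_singleton (D : VirtualKnotDiagram) {c : UnitAddCircle × UnitAddCircle}
    (hc : c ∈ D.crossings) : (D.switch {c}).virtualize {c.swap} = D.virtualize {c} := by
  refine VirtualKnotDiagram.ext rfl (Finset.ext fun d => ?_)
  have hs := D.asymm c hc
  simp only [mem_crossings_virtualize, mem_crossings_switch, Finset.mem_singleton]
  have h1 : d.swap = c ↔ d = c.swap := by
    constructor
    · rintro rfl; simp
    · rintro rfl; simp
  rw [h1]
  constructor
  · rintro ⟨h | h, h'⟩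
    · exact h
    · exact absurd h.2 h'
  · rintro ⟨h, h'⟩
    exact ⟨Or.inl ⟨h, h'⟩, fun e => hs (e ▸ h)⟩

/-- A double point is the difference of two semi-virtual crossings. -/
lemma of_sub_of_switch (D : VirtualKnotDiagram) {c : UnitAddCircle × UnitAddCircle}
    (hc : c ∈ D.crossings) :
    FreeAbelianGroup.of D - FreeAbelianGroup.of (D.switch {c}) =
      D.semiVirtual {c} - (D.switch {c}).semiVirtual {c.swap} := by
  rw [semiVirtual_singleton, semiVirtual_singleton, virtualize_switch_singleton D hc]
  abel

/-! ### Sets of crossings, followed through switchings -/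

open scoped Classical in
/-- The crossing of `D.switch T` that lies at the same double point as the crossing `c` of `D`. -/
noncomputable def switchCrossing (T : Finset (UnitAddCircle × UnitAddCircle))
    (c : UnitAddCircle × UnitAddCircle) : UnitAddCircle × UnitAddCircle :=
  if c ∈ T then c.swap else c

/-- A collision could only come from a pair `c`, `c.swap` with exactly one member in `T`; `asymm`
keeps such a pair from lying in `D.crossings`. -/
lemma switchCrossing_injOn (D : VirtualKnotDiagram)
    (T : Finset (UnitAddCircle × UnitAddCircle)) :
    Set.InjOn (switchCrossing T) D.crossings := by
  intro c hc d hd h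
  unfold switchCrossing at h
  split_ifs at h
  · exact Prod.swap_injective h
  · exact absurd (h ▸ hd) (D.asymm c hc)
  · exact absurd (h ▸ hc) (D.asymm d hd)
  · exact h

lemma switchCrossing_mem {D : VirtualKnotDiagram} (T : Finset (UnitAddCircle × UnitAddCircle))
    {c : UnitAddCircle × UnitAddCircle} (hc : c ∈ D.crossings) :
    switchCrossing T c ∈ (D.switch T).crossings := by
  rw [mem_crossings_switch]
  unfold switchCrossing
  split_ifs with h
  · exact Or.inr ⟨hc, h⟩
  · exact Or.inl ⟨hc, h⟩

-- At a double point of `U` both orders of operation leave a virtual crossing; elsewhere making `U`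
-- virtual has no effect.
open scoped Classical in
lemma virtualize_switch (D : VirtualKnotDiagram)
    {T U : Finset (UnitAddCircle × UnitAddCircle)} (hU : U ⊆ D.crossings) :
    (D.switch T).virtualize (U.image (switchCrossing T)) = (D.virtualize U).switch T := by
  refine VirtualKnotDiagram.ext rfl (Finset.ext fun d => ?_)
  simp only [mem_crossings_virtualize, mem_crossings_switch]
  have key : ∀ c ∈ D.crossings, (switchCrossing T c ∈ U.image (switchCrossing T) ↔ c ∈ U) := by
    intro c hc
    rw [Finset.mem_image]
    refine ⟨?_, fun h => ⟨c, h, rfl⟩⟩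
    rintro ⟨e, he, h⟩
    exact D.switchCrossing_injOn T (hU he) hc h ▸ he
  rw [or_and_right]
  refine or_congr ?_ ?_
  · constructor
    · rintro ⟨⟨h1, h2⟩, h3⟩
      have := key d h1
      rw [switchCrossing, if_neg h2] at this
      exact ⟨⟨h1, mt this.2 h3⟩, h2⟩
    · rintro ⟨⟨h1, h2⟩, h3⟩
      have := key d h1
      rw [switchCrossing, if_neg h3] at this
      exact ⟨⟨h1, h3⟩, mt this.1 h2⟩
  · constructor
    · rintro ⟨⟨h1, h2⟩, h3⟩
      have := key _ h1
      rw [switchCrossing, if_pos h2, Prod.swap_swap] at this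
      exact ⟨⟨h1, mt this.2 h3⟩, h2⟩
    · rintro ⟨⟨h1, h2⟩, h3⟩
      have := key _ h1
      rw [switchCrossing, if_pos h3, Prod.swap_swap] at this
      exact ⟨⟨h1, h3⟩, mt this.1 h2⟩

-- The crossing `u` is no longer real after `U` is made virtual, so there is nothing to switch.
open scoped Classical in
lemma virtualize_switch_insert (D : VirtualKnotDiagram)
    {T U : Finset (UnitAddCircle × UnitAddCircle)} {u : UnitAddCircle × UnitAddCircle}
    (hu : u ∈ U) : (D.virtualize U).switch (insert u T) = (D.virtualize U).switch T := by
  refine VirtualKnotDiagram.ext rfl (Finset.ext fun d => ?_)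
  simp only [mem_crossings_virtualize, mem_crossings_switch, Finset.mem_insert]
  have key : ∀ c, c ∉ U → (c = u ∨ c ∈ T ↔ c ∈ T) := fun c hc =>
    or_iff_right fun h => hc (h ▸ hu)
  refine or_congr (and_congr_right fun h => ?_) (and_congr_right fun h => ?_)
  · rw [key _ h.2]
  · rw [key _ h.2]

/-- An alternating sum over switchings vanishes when one of the switched crossings is virtual. -/
lemma sum_switch_virtualize_eq_zero {A : Type*} [AddCommGroup A] (f : VirtualKnotDiagram → A)
    (D : VirtualKnotDiagram) {S U : Finset (UnitAddCircle × UnitAddCircle)} (hUS : U ⊆ S)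
    (hU : U.Nonempty) :
    ∑ T ∈ S.powerset, (-1 : ℤ) ^ T.card • f ((D.virtualize U).switch T) = 0 := by
  classical
  obtain ⟨u, hu⟩ := hU
  -- Pair each `T` avoiding `u` with `insert u T`: the diagrams agree and the signs are opposite.
  rw [← Finset.insert_erase (hUS hu), Finset.sum_powerset_insert (Finset.notMem_erase u S),
    ← Finset.sum_add_distrib]
  refine Finset.sum_eq_zero fun T hT => ?_
  have huT : u ∉ T := fun h => Finset.notMem_erase u S (Finset.mem_powerset.1 hT h)
  rw [virtualize_switch_insert D hu, Finset.card_insert_of_notMem huT, pow_succ]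
  simp

-- Indexing by subsets of `S` instead of its image removes `T` from the index set, so that the sums
-- over `T` and `U` can be exchanged.
open scoped Classical in
lemma semiVirtual_switch (D : VirtualKnotDiagram)
    {S : Finset (UnitAddCircle × UnitAddCircle)} (hS : S ⊆ D.crossings)
    (T : Finset (UnitAddCircle × UnitAddCircle)) :
    (D.switch T).semiVirtual (S.image (switchCrossing T)) =
      ∑ U ∈ S.powerset,
        (-1 : ℤ) ^ U.card • FreeAbelianGroup.of ((D.virtualize U).switch T) := by
  have hinj := D.switchCrossing_injOn T
  rw [semiVirtual, Finset.powerset_image, Finset.sum_image]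
  · refine Finset.sum_congr rfl fun U hU => ?_
    have hU' := (Finset.mem_powerset.1 hU).trans hS
    rw [virtualize_switch D hU', Finset.card_image_of_injOn (hinj.mono hU')]
  · intro U hU V hV h
    have hU' := (Finset.mem_powerset.1 hU).trans hS
    have hV' := (Finset.mem_powerset.1 hV).trans hS
    have h' : switchCrossing T '' U = switchCrossing T '' V := by
      simpa using congrArg (fun W : Finset _ => (W : Set (UnitAddCircle × UnitAddCircle))) h
    exact Finset.coe_injective ((hinj.image_eq_image_iff hU' hV').1 h')

open scoped Classical in
/-- A diagram with double points at `S` is an alternating sum of diagrams with semi-virtual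
crossings at `S`. -/
lemma sum_switch_eq_sum_semiVirtual (D : VirtualKnotDiagram)
    {S : Finset (UnitAddCircle × UnitAddCircle)} (hS : S ⊆ D.crossings) :
    ∑ T ∈ S.powerset, (-1 : ℤ) ^ T.card • FreeAbelianGroup.of (D.switch T) =
      ∑ T ∈ S.powerset, (-1 : ℤ) ^ T.card •
        (D.switch T).semiVirtual (S.image (switchCrossing T)) := by
  simp only [semiVirtual_switch D hS, Finset.smul_sum]
  symm
  rw [Finset.sum_comm, Finset.sum_eq_single_of_mem ∅ (Finset.empty_mem_powerset S)]
  · simp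
  · intro U hU hne
    -- The zero on the right is replaced by the vanishing sum for `U`, scaled by its sign; the two
    -- sides then differ only in the order of the signs.
    rw [← smul_zero ((-1 : ℤ) ^ U.card), ← sum_switch_virtualize_eq_zero FreeAbelianGroup.of D
      (Finset.mem_powerset.1 hU) (Finset.nonempty_iff_ne_empty.2 hne), Finset.smul_sum]
    exact Finset.sum_congr rfl fun T _ => smul_comm _ _ _

end VirtualKnotDiagram

/-- The restriction of a finite type invariant of virtual knots to classical knots is a finite type
invariant of at most the same degree. -/
lemma VirtualKnot.FiniteTypeLE.restrict {G : Type*} [AddCommGroup G] {ν : VirtualKnot → G} {n : ℕ}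
    (hν : VirtualKnot.FiniteTypeLE ν n) :
    ClassicalKnot.FiniteTypeLE (fun K => ν K.toVirtual) n := by
  classical
  intro D S hS hcard
  have h := congrArg (VirtualKnot.extend ν) (D.1.sum_switch_eq_sum_semiVirtual hS)
  simp only [map_sum, map_zsmul] at h
  refine Eq.trans (Finset.sum_congr rfl fun T _ => ?_) (h.trans (Finset.sum_eq_zero fun T _ => ?_))
  -- Viewing the class of a classical diagram as a virtual knot gives, by definition, the class of
  -- the same diagram.
  · rw [VirtualKnot.extend, FreeAbelianGroup.lift_apply_of]
    rfl
  · rw [hν, smul_zero]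
    · intro d hd
      obtain ⟨c, hc, rfl⟩ := Finset.mem_image.1 hd
      exact VirtualKnotDiagram.switchCrossing_mem T (hS hc)
    -- Injectivity keeps the number of semi-virtual crossings at `n + 1`, just above the degree
    -- bound.
    · rw [Finset.card_image_of_injOn ((D.1.switchCrossing_injOn T).mono hS)]
      omega

end VirtualKnotTheory

theorem mainTheorem5 :
    (∀ (D : VirtualKnotTheory.VirtualKnotDiagram) (c : UnitAddCircle × UnitAddCircle),
      c ∈ D.crossings →
        FreeAbelianGroup.of D - FreeAbelianGroup.of (D.switch {c}) =
          D.semiVirtual {c} - (D.switch {c}).semiVirtual {c.swap}) ∧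
    ∀ {G : Type*} [AddCommGroup G] (ν : VirtualKnotTheory.VirtualKnot → G) (n : ℕ),
      VirtualKnotTheory.VirtualKnot.FiniteTypeLE ν n →
        VirtualKnotTheory.ClassicalKnot.FiniteTypeLE
          (fun K => ν (VirtualKnotTheory.ClassicalKnot.toVirtual K)) n :=
  ⟨fun D _ hc => D.of_sub_of_switch hc, fun _ _ hν => hν.restrict⟩
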